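/- Consider an unbiased fully-connected ReLU network with input dimension $n\ge 1$ (layer $0$ is the input $\mathbf{x}\in\mathbb{R}^n$; each node of a hidden layer outputs $\max(0,\cdot)$ of a linear combination, without constant term, of the outputs of the preceding layer), and let $f:\mathbb{R}^n\to\mathbb{R}$ be the output of one of its hidden nodes. Let $F(\boldsymbol\omega)=(2\pi)^{-n/2}\int_{[0,1]^n}e^{-\mathfrak{i}\,\boldsymbol\omega\cdot\mathbf{x}}f(\mathbf{x})\,d\mathbf{x}$ be the Fourier transform of $f$ restricted to the unit cube $[0,1]^n$ (and extended by $0$). Let $$S(\boldsymbol\omega)=(2\pi)^{-n/2}\int_{\{\mathbf{x}\,:\,x_1,\dots,x_n>0,\;x_1+\dots+x_n\le 1\}}e^{-\mathfrak{i}\,\boldsymbol\omega\cdot\mathbf{x}}\,d\mathbf{x}.$$ For linearly independent vectors $\mathbf{V}=\{\mathbf{v}_1,\dots,\mathbf{v}_n\}$ in $\mathbb{R}^n$ write $\mathfrak{R}^+_{\mathbf{V}}=\{\sum_k\alpha_k\mathbf{v}_k : \alpha_1,\dots,\alpha_n>0\}$. A *normalized simplicial decomposition* for $f$ consists of finitely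 many linearly independent systems $\mathbf{V}_q$, weight vectors $\mathbf{w}_q\in\mathbb{R}^n$, indices $r_q\in\{1,\dots,n\}$ and matrices $\mathbf{A}_q\in\mathbb{R}^{n\times n}$ $(q=1,\dots,Q)$ such that: the cones $\mathfrak{R}^+_{\mathbf{V}_q}$ are pairwise disjoint and contained in the open positive orthant, and their closures cover the closed positive orthant; $f(\mathbf{x})=\mathbf{w}_q\cdot\mathbf{x}$ and $\max_i|x_i|=|x_{r_q}|$ on $\mathfrak{R}^+_{\mathbf{V}_q}$; $\mathbf{A}_q$ sends the vectors of $\mathbf{V}_q$ to the standard basis vectors (so it maps the cone onto the positive orthant), and the sum of the coordinates of $\mathbf{A}_q\mathbf{x}$ equals $x_{r_q}$ for all $\mathbf{x}\in\mathbb{R}^n$. Then: 1. The functions whose Fourier transforms are $S$ and $F$ are integrable, $S$ is differentiable on $\mathbb{R}^n$, and whenever $\omega_0:=0,\omega_1,\dots,\omega_n$ are pairwise distinct, $$S(\boldsymbol{\omega})=\Big(\frac{-\mathfrak{i}}{\sqrt{2\pi}}\Big)^n\sum_{r=0}^n\frac{e^{-\mathfrak{i}\omega_r}}{\prod_{r'\neq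 r}(\omega_{r'}-\omega_r)}.$$ 2. A normalized simplicial decomposition for $f$ exists. 3. For every normalized simplicial decomposition for $f$, the restriction of $f$ to the cube (extended by $0$) is equal almost everywhere to $\sum_{q=1}^Q g_q$, where $g_q(\mathbf{x})=\mathbf{w}_q\cdot\mathbf{x}$ if $\mathbf{x}\in\mathfrak{R}^+_{\mathbf{V}_q}$ and $x_{r_q}\le 1$, and $g_q(\mathbf{x})=0$ otherwise; and for every $\boldsymbol\omega\in\mathbb{R}^n$ $$F(\boldsymbol\omega)=\sum_{q=1}^Q\frac{\mathfrak{i}}{|\det\mathbf{A}_q|}\;\mathbf{w}_q\mathbf{A}_q^{-1}\cdot\nabla S(\boldsymbol\omega\mathbf{A}_q^{-1}),$$ where $\mathbf{w}_q$ and $\boldsymbol\omega$ are row vectors. Equivalently, $F(\boldsymbol\omega)=\sum_q\tilde{\mathbf{w}}_q\mathbf{A}_q^{-1}\cdot\nabla S(\boldsymbol\omega\mathbf{A}_q^{-1})$ with the rescaled complex weights $\tilde{\mathbf{w}}_q=\frac{\mathfrak{i}}{|\det\mathbf{A}_q|}\mathbf{w}_q$. -/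

import Mathlib

open MeasureTheory Matrix

noncomputable section

/-- An unbiased fully-connected ReLU network with `depth` hidden layers. `width 0` is the dimension
of the input, `width (l + 1)` the number of nodes of the `(l + 1)`-st layer, and `weight l` the
weight matrix from layer `l` to layer `l + 1`. Only the layers `1, …, depth` are hidden layers. -/
structure ReLUNetwork where
  depth : ℕ
  width : ℕ → ℕ
  weight : (l : ℕ) → Matrix (Fin (width (l + 1))) (Fin (width l)) ℝ

namespace ReLUNetwork

/-- The vector of the outputs of the nodes of layer `l` on input `x`; layer `0` is the input. -/
def layer (N : ReLUNetwork) (x : Fin (N.width 0) → ℝ) : (l : ℕ) → Fin (N.width l) → ℝ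
  | 0 => x
  | l + 1 => fun j => max 0 ((N.weight l *ᵥ N.layer x l) j)

end ReLUNetwork

/-- The Fourier transform `(2π)^(-n/2) ∫ e^(-i ω·x) f(x) dx` on `ℝⁿ`. -/
def fourierTr {n : ℕ} (f : (Fin n → ℝ) → ℂ) (ω : Fin n → ℝ) : ℂ :=
  ((1 / Real.sqrt (2 * Real.pi) : ℝ) : ℂ) ^ n *
    ∫ x : Fin n → ℝ, Complex.exp (-Complex.I * ((ω ⬝ᵥ x : ℝ) : ℂ)) * f x

/-- The gradient (vector of partial derivatives) of a complex-valued function on `ℝⁿ`. -/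
def grad {n : ℕ} (F : (Fin n → ℝ) → ℂ) (ω : Fin n → ℝ) : Fin n → ℂ :=
  fun k => fderiv ℝ F ω (Pi.single k 1)

/-- The infinite simplex (open simplicial cone) spanned by `v 0, …, v (n - 1)`. -/
def infiniteSimplex {n : ℕ} (v : Fin n → Fin n → ℝ) : Set (Fin n → ℝ) :=
  {x | ∃ α : Fin n → ℝ, (∀ k, 0 < α k) ∧ x = ∑ k, α k • v k}

/-- The function on `ℝⁿ` that agrees with `f` on the unit cube `[0,1]ⁿ` and is zero elsewhere. -/
def cubeRestrict {n : ℕ} (f : (Fin n → ℝ) → ℝ) : (Fin n → ℝ) → ℝ :=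
  (Set.Icc (0 : Fin n → ℝ) 1).indicator f

/-- The function that is `1` at the points `x` of the infinite simplex of the standard basis
with `x₁ + ⋯ + xₙ ≤ 1`, and zero elsewhere. -/
def simplexFn (n : ℕ) : (Fin n → ℝ) → ℝ :=
  {x | x ∈ infiniteSimplex (fun k : Fin n => (Pi.single k 1 : Fin n → ℝ)) ∧
    ∑ i, x i ≤ 1}.indicator (fun _ => 1)

/-- The Fourier transform `S` of `simplexFn n`. -/
def simplexFT (n : ℕ) : (Fin n → ℝ) → ℂ :=
  fourierTr (fun x => (simplexFn n x : ℂ))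

/-- The closed form
`(-i / √(2π))^n ∑_{r=0}^n e^(-i ω_r) / ∏_{r' ≠ r} (ω_{r'} - ω_r)`, with `ω_0 = 0`. -/
def simplexFTFormula (n : ℕ) (ω : Fin n → ℝ) : ℂ :=
  let ω' : Fin (n + 1) → ℝ := Fin.cons 0 ω
  (-Complex.I / ((Real.sqrt (2 * Real.pi) : ℝ) : ℂ)) ^ n *
    ∑ r, Complex.exp (-Complex.I * (ω' r : ℂ)) /
      ∏ r' ∈ Finset.univ.erase r, ((ω' r' : ℂ) - (ω' r : ℂ))

/-- The function `x ↦ w · x` on the part `x_r ≤ 1` of the infinite simplex of `v`, and zero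
elsewhere. -/
def pieceFn {n : ℕ} (v : Fin n → Fin n → ℝ) (w : Fin n → ℝ) (r : Fin n) : (Fin n → ℝ) → ℝ :=
  {x | x ∈ infiniteSimplex v ∧ x r ≤ 1}.indicator (fun x => w ⬝ᵥ x)

/-- The infinite simplices of `V 0, …, V (Q - 1)` decompose the positive orthant, `f` is the linear
function `w q · x` on the `q`-th one, the coordinate `r q` is the largest one on it, and the matrix
`A q` sends the vectors `V q` to the standard basis, so that the sum of the new coordinates `A q x`
is `x_{r q}`. -/
structure IsSimplicialDecomposition {n Q : ℕ} (f : (Fin n → ℝ) → ℝ)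
    (V : Fin Q → Fin n → Fin n → ℝ) (w : Fin Q → Fin n → ℝ) (r : Fin Q → Fin n)
    (A : Fin Q → Matrix (Fin n) (Fin n) ℝ) : Prop where
  linearIndependent : ∀ q, LinearIndependent ℝ (V q)
  pos : ∀ q, ∀ x ∈ infiniteSimplex (V q), ∀ i, 0 < x i
  disjoint : ∀ q q', q ≠ q' → Disjoint (infiniteSimplex (V q)) (infiniteSimplex (V q'))
  cover : ∀ x : Fin n → ℝ, (∀ i, 0 ≤ x i) → ∃ q, x ∈ closure (infiniteSimplex (V q))
  linear : ∀ q, ∀ x ∈ infiniteSimplex (V q), f x = w q ⬝ᵥ x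
  largest : ∀ q, ∀ x ∈ infiniteSimplex (V q), ∀ i, |x i| ≤ |x (r q)|
  map_basis : ∀ q k, A q *ᵥ V q k = Pi.single k 1
  sum_coord : ∀ q, ∀ x : Fin n → ℝ, ∑ k, (A q *ᵥ x) k = x (r q)

end

/-!
A simplicial cone is cut in two by a ray `a • v i + b • v j` inside one of its two-dimensional
faces. For a linear functional `h` with `h (v i) > 0 > h (v j)`, cutting along the ray on which `h`
vanishes decreases the number of generators off the hyperplane `h = 0`, so after finitely many cuts
`h` has constant sign on every cone (`subdivides_constSign`). No compatibility between faces of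
neighbouring cones is required, so the cones can be treated independently of one another.

Applied to the functionals `x i - x j`, this makes one coordinate dominate on every cone of the
positive orthant. Applied to the preactivations of a layer, on cones on which the preceding layer is
already linear, it makes the layer linear on every cone (`subdivides_layer_linear`). Scaling the
generators to dominating coordinate `1` and inverting the matrix they form then gives the normalized
decomposition (`exists_isSimplicialDecomposition`).

The integral of `e^(-i ω · x)` over the standard simplex of size `t` is, up to the factor `(-i)^n`,
the sum `dividedExp` at the nodes `0, ω 0, …, ω (n - 1)`. Slicing along the last coordinate adds one
node (`integral_scaledSimplex_succ`, `integral_exp_mul_dividedExp`); the boundary terms combine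
because the divided difference of a constant vanishes (`dividedExp_zero`).

For a given decomposition, the frontiers of the cones are null sets because the cones are convex, and
the dominating coordinate decides whether a point of a cone is in the cube; hence the restriction to
the cube is almost everywhere the sum of the pieces. The substitution `y = A x` maps each piece to
`(w A⁻¹ · y)` times the indicator of the standard simplex, and the coordinate factors `y k` are
derivatives of `simplexFT` by `grad_fourierTr`; this is `fourierTr_pieceFn`.
-/

/-! ### Subdivision of simplicial cones -/

/-- The closed simplicial cone spanned by `v 0, …, v (n - 1)`. -/
def closedSimplex {n : ℕ} (v : Fin n → Fin n → ℝ) : Set (Fin n → ℝ) :=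
  {x | ∃ α : Fin n → ℝ, (∀ k, 0 ≤ α k) ∧ x = ∑ k, α k • v k}

/-- `Subdivides Φ v` says that the simplicial cone of `v` can be cut into finitely many simplicial
cones, all satisfying `Φ`, by repeatedly cutting a cone in two along a new ray `a • v i + b • v j`
in the relative interior of one of its two-dimensional faces. -/
inductive Subdivides {n : ℕ} (Φ : (Fin n → Fin n → ℝ) → Prop) : (Fin n → Fin n → ℝ) → Prop
  | leaf (v) : Φ v → Subdivides Φ v
  | split (v) (i j : Fin n) (a b : ℝ) (hij : i ≠ j) (ha : 0 < a) (hb : 0 < b) :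
      Subdivides Φ (Function.update v i (a • v i + b • v j)) →
      Subdivides Φ (Function.update v j (b • v j + a • v i)) → Subdivides Φ v

section Split

variable {n : ℕ}

theorem sum_smul_update (v : Fin n → Fin n → ℝ) (α : Fin n → ℝ) (i : Fin n) (u : Fin n → ℝ) :
    ∑ k, α k • Function.update v i u k = ∑ k, α k • v k + α i • (u - v i) := by
  rw [← sub_eq_iff_eq_add', ← Finset.sum_sub_distrib, Finset.sum_eq_single i]
  · simp [smul_sub]
  · intro k _ hk
    simp [Function.update_of_ne hk]
  · simp

theorem sum_update_smul (v : Fin n → Fin n → ℝ) (α : Fin n → ℝ) (i : Fin n) (c : ℝ) :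
    ∑ k, Function.update α i c k • v k = ∑ k, α k • v k + (c - α i) • v i := by
  rw [← sub_eq_iff_eq_add', ← Finset.sum_sub_distrib, Finset.sum_eq_single i]
  · simp [sub_smul]
  · intro k _ hk
    simp [Function.update_of_ne hk]
  · simp

/-- The coordinates with respect to `v` of a combination of the system in which `v i` is replaced
by `a • v i + b • v j`. -/
noncomputable def splitCoord (α : Fin n → ℝ) (i j : Fin n) (a b : ℝ) : Fin n → ℝ :=
  Function.update (Function.update α i (a * α i)) j (α j + b * α i)

theorem splitCoord_fst (α : Fin n → ℝ) {i j : Fin n} (hij : i ≠ j) (a b : ℝ) :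
    splitCoord α i j a b i = a * α i := by
  simp [splitCoord, hij]

theorem splitCoord_snd (α : Fin n → ℝ) (i j : Fin n) (a b : ℝ) :
    splitCoord α i j a b j = α j + b * α i := by
  simp [splitCoord]

theorem splitCoord_of_ne (α : Fin n → ℝ) {i j k : Fin n} (hi : k ≠ i) (hj : k ≠ j) (a b : ℝ) :
    splitCoord α i j a b k = α k := by
  simp [splitCoord, hi, hj]

theorem sum_smul_split (v : Fin n → Fin n → ℝ) (α : Fin n → ℝ) {i j : Fin n} (hij : i ≠ j)
    (a b : ℝ) :
    ∑ k, α k • Function.update v i (a • v i + b • v j) k =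
      ∑ k, splitCoord α i j a b k • v k := by
  rw [splitCoord, sum_smul_update, sum_update_smul, sum_update_smul,
    Function.update_of_ne hij.symm]
  module

theorem splitCoord_pos {α : Fin n → ℝ} (hα : ∀ k, 0 < α k) {i j : Fin n} (hij : i ≠ j)
    {a b : ℝ} (ha : 0 < a) (hb : 0 < b) (k : Fin n) : 0 < splitCoord α i j a b k := by
  by_cases hi : k = i
  · subst hi
    rw [splitCoord_fst _ hij]
    exact mul_pos ha (hα _)
  by_cases hj : k = j
  · subst hj
    rw [splitCoord_snd]
    exact add_pos (hα _) (mul_pos hb (hα _))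
  rw [splitCoord_of_ne _ hi hj]
  exact hα k

theorem linearIndependent_split {v : Fin n → Fin n → ℝ} (hv : LinearIndependent ℝ v) {i j : Fin n}
    (hij : i ≠ j) {a : ℝ} (b : ℝ) (ha : 0 < a) :
    LinearIndependent ℝ (Function.update v i (a • v i + b • v j)) := by
  rw [Fintype.linearIndependent_iff] at hv ⊢
  intro g hg
  rw [sum_smul_split v g hij] at hg
  have h := hv _ hg
  have hi : g i = 0 := by
    have := h i
    rw [splitCoord_fst _ hij] at this
    exact (mul_eq_zero.mp this).resolve_left ha.ne'
  intro k
  by_cases hki : k = i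
  · rw [hki, hi]
  by_cases hkj : k = j
  · have := h j
    rw [splitCoord_snd, hi] at this
    rw [hkj]
    linarith
  · have := h k
    rwa [splitCoord_of_ne _ hki hkj] at this

theorem infiniteSimplex_split_subset (v : Fin n → Fin n → ℝ) {i j : Fin n} (hij : i ≠ j)
    {a b : ℝ} (ha : 0 < a) (hb : 0 < b) :
    infiniteSimplex (Function.update v i (a • v i + b • v j)) ⊆ infiniteSimplex v := by
  rintro x ⟨α, hα, rfl⟩
  exact ⟨_, splitCoord_pos hα hij ha hb, sum_smul_split v α hij a b⟩

/-- The two halves of a cut cone are disjoint: in coordinates with respect to `v`, the first lies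
where `b * α i < a * α j`, the second where `a * α j < b * α i`. -/
theorem disjoint_split {v : Fin n → Fin n → ℝ} (hv : LinearIndependent ℝ v) {i j : Fin n}
    (hij : i ≠ j) {a b : ℝ} (ha : 0 < a) (hb : 0 < b) :
    Disjoint (infiniteSimplex (Function.update v i (a • v i + b • v j)))
      (infiniteSimplex (Function.update v j (b • v j + a • v i))) := by
  rw [Set.disjoint_left]
  rintro x ⟨α, hα, rfl⟩ ⟨β, hβ, h⟩
  rw [sum_smul_split v α hij, sum_smul_split v β hij.symm] at h
  have h' : splitCoord α i j a b = splitCoord β j i b a := by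
    rw [← sub_eq_zero]
    funext k
    refine Fintype.linearIndependent_iff.mp hv _ ?_ k
    simp only [Pi.sub_apply, sub_smul, Finset.sum_sub_distrib]
    exact sub_eq_zero.mpr h
  have h1 := congrFun h' i
  have h2 := congrFun h' j
  rw [splitCoord_fst _ hij, splitCoord_snd] at h1
  rw [splitCoord_fst _ hij.symm, splitCoord_snd] at h2
  have h3 := mul_pos ha (hα j)
  have h4 := mul_pos hb (hβ i)
  nlinarith

/-- The part `b * α i ≤ a * α j` of the closed cone of `v` is covered by the half in which `v i` is
replaced: there `α i / a` copies of the new ray use up the whole coefficient of `v i`. -/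
theorem mem_closedSimplex_split {v : Fin n → Fin n → ℝ} {i j : Fin n}
    (hij : i ≠ j) {a b : ℝ} (ha : 0 < a) {α : Fin n → ℝ} (hα : ∀ k, 0 ≤ α k)
    (h : b * α i ≤ a * α j) :
    ∑ k, α k • v k ∈ closedSimplex (Function.update v i (a • v i + b • v j)) := by
  refine ⟨Function.update (Function.update α i (α i / a)) j (α j - b * (α i / a)), ?_, ?_⟩
  · intro k
    by_cases hj : k = j
    · subst hj
      rw [Function.update_self, sub_nonneg, ← mul_div_assoc, div_le_iff₀ ha]
      linarith
    by_cases hi : k = i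
    · subst hi
      rw [Function.update_of_ne hj, Function.update_self]
      exact div_nonneg (hα _) ha.le
    rw [Function.update_of_ne hj, Function.update_of_ne hi]
    exact hα k
  · rw [sum_smul_split _ _ hij]
    congr! 2 with k
    by_cases hj : k = j
    · subst hj
      simp [splitCoord_snd, hij]
    by_cases hi : k = i
    · subst hi
      rw [splitCoord_fst _ hij, Function.update_of_ne hij, Function.update_self]
      field_simp
    rw [splitCoord_of_ne _ hi hj, Function.update_of_ne hj, Function.update_of_ne hi]

theorem closedSimplex_subset_split (v : Fin n → Fin n → ℝ) {i j : Fin n} (hij : i ≠ j)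
    {a b : ℝ} (ha : 0 < a) (hb : 0 < b) :
    closedSimplex v ⊆ closedSimplex (Function.update v i (a • v i + b • v j)) ∪
      closedSimplex (Function.update v j (b • v j + a • v i)) := by
  rintro x ⟨α, hα, rfl⟩
  rcases le_total (b * α i) (a * α j) with h | h
  · exact Or.inl (mem_closedSimplex_split hij ha hα h)
  · exact Or.inr (mem_closedSimplex_split hij.symm hb hα h)

end Split

namespace Subdivides

variable {n : ℕ} {Φ Ψ : (Fin n → Fin n → ℝ) → Prop} {v : Fin n → Fin n → ℝ}

theorem bind (h : Subdivides Φ v) (H : ∀ u, Φ u → Subdivides Ψ u) : Subdivides Ψ v := by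
  induction h with
  | leaf v h => exact H v h
  | split v i j a b hij ha hb _ _ h1 h2 => exact split v i j a b hij ha hb h1 h2

theorem mono (h : Subdivides Φ v) (H : ∀ u, Φ u → Ψ u) : Subdivides Ψ v :=
  h.bind fun u hu => leaf u (H u hu)

/-- A property that passes to both halves of a cut cone holds for all cones of a subdivision. -/
theorem and_hereditary (h : Subdivides Φ v)
    (H : ∀ u (i j : Fin n) (a b : ℝ), i ≠ j → 0 < a → 0 < b → Ψ u →
      Ψ (Function.update u i (a • u i + b • u j)))
    (hv : Ψ v) : Subdivides (fun u => Φ u ∧ Ψ u) v := by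
  induction h with
  | leaf v h => exact leaf v ⟨h, hv⟩
  | split v i j a b hij ha hb _ _ h1 h2 =>
    exact split v i j a b hij ha hb (h1 (H v i j a b hij ha hb hv))
      (h2 (H v j i b a hij.symm hb ha hv))

/-- The cones of a subdivision, as a finite set of systems of vectors. -/
theorem exists_finset (h : Subdivides Φ v) (hv : LinearIndependent ℝ v) :
    ∃ S : Finset (Fin n → Fin n → ℝ),
      (∀ u ∈ S, Φ u ∧ LinearIndependent ℝ u ∧ infiniteSimplex u ⊆ infiniteSimplex v) ∧
      (∀ u ∈ S, ∀ u' ∈ S, u ≠ u' → Disjoint (infiniteSimplex u) (infiniteSimplex u')) ∧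
      ∀ x ∈ closedSimplex v, ∃ u ∈ S, x ∈ closedSimplex u := by
  classical
  induction h with
  | leaf v h =>
    refine ⟨{v}, by simpa using ⟨h, hv⟩, ?_, by simp⟩
    simp only [Finset.mem_singleton]
    rintro u rfl u' rfl h
    exact absurd rfl h
  | split v i j a b hij ha hb _ _ h1 h2 =>
    obtain ⟨S, hS, dS, cS⟩ := h1 (linearIndependent_split hv hij b ha)
    obtain ⟨T, hT, dT, cT⟩ := h2 (linearIndependent_split hv hij.symm a hb)
    have hd := disjoint_split hv hij ha hb
    refine ⟨S ∪ T, ?_, ?_, ?_⟩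
    · intro u hu
      rcases Finset.mem_union.mp hu with hu | hu
      · exact ⟨(hS u hu).1, (hS u hu).2.1,
          (hS u hu).2.2.trans (infiniteSimplex_split_subset v hij ha hb)⟩
      · exact ⟨(hT u hu).1, (hT u hu).2.1,
          (hT u hu).2.2.trans (infiniteSimplex_split_subset v hij.symm hb ha)⟩
    · intro u hu u' hu' hne
      rcases Finset.mem_union.mp hu with hu | hu <;> rcases Finset.mem_union.mp hu' with hu' | hu'
      · exact dS u hu u' hu' hne
      · exact hd.mono (hS u hu).2.2 (hT u' hu').2.2
      · exact hd.symm.mono (hT u hu).2.2 (hS u' hu').2.2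
      · exact dT u hu u' hu' hne
    · intro x hx
      rcases closedSimplex_subset_split v hij ha hb hx with hx | hx
      · obtain ⟨u, hu, hxu⟩ := cS x hx
        exact ⟨u, Finset.mem_union_left _ hu, hxu⟩
      · obtain ⟨u, hu, hxu⟩ := cT x hx
        exact ⟨u, Finset.mem_union_right _ hu, hxu⟩

end Subdivides

/-! ### Cutting cones along hyperplanes -/

/-- The linear functional `h · x` does not change sign on the cone of `v`. -/
def ConstSign {n : ℕ} (h : Fin n → ℝ) (v : Fin n → Fin n → ℝ) : Prop :=
  (∀ k, 0 ≤ h ⬝ᵥ v k) ∨ ∀ k, h ⬝ᵥ v k ≤ 0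

section Sign

variable {n : ℕ}

theorem ConstSign.split {h : Fin n → ℝ} {v : Fin n → Fin n → ℝ} (hs : ConstSign h v) (i j : Fin n)
    {a b : ℝ} (ha : 0 < a) (hb : 0 < b) :
    ConstSign h (Function.update v i (a • v i + b • v j)) := by
  refine hs.imp (fun hs k => ?_) (fun hs k => ?_) <;> by_cases hk : k = i
  · subst hk
    have h1 := mul_nonneg ha.le (hs k)
    have h2 := mul_nonneg hb.le (hs j)
    simpa [dotProduct_add, dotProduct_smul] using add_nonneg h1 h2
  · simpa [hk] using hs k
  · subst hk
    have h1 := mul_nonpos_of_nonneg_of_nonpos ha.le (hs k)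
    have h2 := mul_nonpos_of_nonneg_of_nonpos hb.le (hs j)
    simpa [dotProduct_add, dotProduct_smul] using add_nonpos h1 h2
  · simpa [hk] using hs k

/-- Cutting a cone along the hyperplane `h · x = 0`. If `h` is positive at `v i` and negative at
`v j`, then the cone is cut along the ray on which `h` vanishes in the face of `v i` and `v j`, and
both halves have fewer generators off the hyperplane. -/
theorem subdivides_constSign (h : Fin n → ℝ) (v : Fin n → Fin n → ℝ) :
    Subdivides (ConstSign h) v := by
  classical
  induction hm : (Finset.univ.filter fun k => h ⬝ᵥ v k ≠ 0).card using
    Nat.strong_induction_on generalizing v with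
  | _ m ih =>
    by_cases hs : ConstSign h v
    · exact .leaf v hs
    obtain ⟨⟨j, hj⟩, i, hi⟩ : (∃ j, h ⬝ᵥ v j < 0) ∧ ∃ i, 0 < h ⬝ᵥ v i := by
      simpa [ConstSign] using hs
    have hij : i ≠ j := by
      rintro rfl
      exact lt_asymm hi hj
    have key (k : Fin n) (u : Fin n → ℝ) (hk : h ⬝ᵥ v k ≠ 0) (hu : h ⬝ᵥ u = 0) :
        Subdivides (ConstSign h) (Function.update v k u) := by
      refine ih _ ?_ _ rfl
      rw [← hm]
      refine Finset.card_lt_card (Finset.ssubset_iff_subset_ne.mpr ⟨fun l hl => ?_, fun he => ?_⟩)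
      · by_cases hlk : l = k
        · simpa [hlk] using hk
        · simpa [hlk] using hl
      · have : k ∈ Finset.univ.filter fun l => h ⬝ᵥ v l ≠ 0 := by simpa using hk
        rw [← he] at this
        simp [hu] at this
    refine .split v i j (-(h ⬝ᵥ v j)) (h ⬝ᵥ v i) hij (neg_pos.mpr hj) hi
      (key i _ hi.ne' ?_) (key j _ hj.ne ?_)
    · rw [dotProduct_add, dotProduct_smul, dotProduct_smul]
      simp only [smul_eq_mul]
      ring
    · rw [dotProduct_add, dotProduct_smul, dotProduct_smul]
      simp only [smul_eq_mul]
      ring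

theorem subdivides_forall_constSign (H : Finset (Fin n → ℝ)) (v : Fin n → Fin n → ℝ) :
    Subdivides (fun u => ∀ h ∈ H, ConstSign h u) v := by
  classical
  induction H using Finset.induction_on with
  | empty => exact .leaf v (by simp)
  | insert h H _ ih =>
    refine ih.bind fun u hu => ?_
    refine ((subdivides_constSign h u).and_hereditary
      (Ψ := fun u => ∀ h ∈ H, ConstSign h u) ?_ hu).mono ?_
    · exact fun u i j a b _ ha hb hu h hh => (hu h hh).split i j ha hb
    · rintro u ⟨h1, h2⟩
      simpa using ⟨h1, h2⟩

theorem ConstSign.on_infiniteSimplex {h : Fin n → ℝ} {v : Fin n → Fin n → ℝ} (hs : ConstSign h v) :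
    (∀ x ∈ infiniteSimplex v, 0 ≤ h ⬝ᵥ x) ∨ ∀ x ∈ infiniteSimplex v, h ⬝ᵥ x ≤ 0 := by
  refine hs.imp ?_ ?_
  · rintro hs _ ⟨α, hα, rfl⟩
    simp only [dotProduct_sum, dotProduct_smul, smul_eq_mul]
    exact Finset.sum_nonneg fun k _ => mul_nonneg (hα k).le (hs k)
  · rintro hs _ ⟨α, hα, rfl⟩
    simp only [dotProduct_sum, dotProduct_smul, smul_eq_mul]
    exact Finset.sum_nonpos fun k _ => mul_nonpos_of_nonneg_of_nonpos (hα k).le (hs k)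

/-- Any cone can be subdivided so that on every part one coordinate dominates the others. -/
theorem subdivides_largest [NeZero n] (v : Fin n → Fin n → ℝ) :
    Subdivides (fun u => ∃ r, ∀ k i, u k i ≤ u k r) v := by
  classical
  refine (subdivides_forall_constSign (Finset.univ.image fun p : Fin n × Fin n =>
    (Pi.single p.1 1 - Pi.single p.2 1 : Fin n → ℝ)) v).mono fun u hu => ?_
  -- the coordinate that is largest at the sum of the generators
  obtain ⟨r, -, hr⟩ := Finset.exists_max_image Finset.univ (fun i => ∑ k, u k i)
    Finset.univ_nonempty
  refine ⟨r, fun k i => ?_⟩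
  have h := hu _ (Finset.mem_image_of_mem _ (Finset.mem_univ (r, i)))
  simp only [ConstSign, sub_dotProduct, single_one_dotProduct, sub_nonneg] at h
  rcases h with h | h
  · exact h k
  · have h0 : ∑ k, (u k r - u k i) = 0 := by
      refine le_antisymm (Finset.sum_nonpos fun k _ => h k) ?_
      rw [Finset.sum_sub_distrib, sub_nonneg]
      exact hr i (Finset.mem_univ i)
    have := (Finset.sum_eq_zero_iff_of_nonpos fun k _ => h k).mp h0 k (Finset.mem_univ k)
    linarith

/-- Any cone can be subdivided so that every node of the layer is linear on every part: a node is
`max 0 (h · x)` on a cone on which the preceding layer is linear, so it is linear on those parts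
where `h · x` does not change sign. -/
theorem subdivides_layer_linear (N : ReLUNetwork) (l : ℕ)
    (v : Fin (N.width 0) → Fin (N.width 0) → ℝ) :
    Subdivides (fun u => ∀ j, ∃ w : Fin (N.width 0) → ℝ,
      ∀ x ∈ infiniteSimplex u, N.layer x l j = w ⬝ᵥ x) v := by
  classical
  induction l with
  | zero =>
    refine .leaf v fun j => ⟨Pi.single j 1, fun x _ => ?_⟩
    rw [single_one_dotProduct]
    rfl
  | succ l ih =>
    refine ih.bind fun u hu => ?_
    choose w hw using hu
    refine ((subdivides_forall_constSign
      (Finset.univ.image fun j => ∑ i, N.weight l j i • w i) u).and_hereditary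
      (Ψ := fun u' => infiniteSimplex u' ⊆ infiniteSimplex u) ?_ subset_rfl).mono ?_
    · exact fun u' i j a b hij ha hb h => (infiniteSimplex_split_subset u' hij ha hb).trans h
    · rintro u' ⟨hs, hsub⟩ j
      have hlin (x) (hx : x ∈ infiniteSimplex u') :
          (N.weight l *ᵥ N.layer x l) j = (∑ i, N.weight l j i • w i) ⬝ᵥ x := by
        change ∑ i, N.weight l j i * N.layer x l i = _
        rw [sum_dotProduct]
        refine Finset.sum_congr rfl fun i _ => ?_
        rw [smul_dotProduct, hw i x (hsub hx), smul_eq_mul]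
      rcases (hs _ (Finset.mem_image_of_mem _ (Finset.mem_univ j))).on_infiniteSimplex with h | h
      · refine ⟨∑ i, N.weight l j i • w i, fun x hx => ?_⟩
        exact (congrArg (max 0) (hlin x hx)).trans (max_eq_right (h x hx))
      · refine ⟨0, fun x hx => ?_⟩
        rw [zero_dotProduct]
        exact (congrArg (max 0) (hlin x hx)).trans (max_eq_left (h x hx))

end Sign

/-! ### Existence of a normalized decomposition -/

section Existence

variable {n : ℕ}

theorem infiniteSimplex_smul (u : Fin n → Fin n → ℝ) {c : Fin n → ℝ} (hc : ∀ k, 0 < c k) :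
    infiniteSimplex (fun k => c k • u k) = infiniteSimplex u := by
  ext x
  constructor
  · rintro ⟨α, hα, rfl⟩
    exact ⟨fun k => α k * c k, fun k => mul_pos (hα k) (hc k), by simp only [smul_smul]⟩
  · rintro ⟨α, hα, rfl⟩
    refine ⟨fun k => α k / c k, fun k => div_pos (hα k) (hc k), ?_⟩
    simp only [smul_smul, div_mul_cancel₀ _ (hc _).ne']

theorem closedSimplex_subset_closure (v : Fin n → Fin n → ℝ) :
    closedSimplex v ⊆ closure (infiniteSimplex v) := by
  rintro x ⟨α, hα, rfl⟩
  have hcont : Continuous fun t : ℝ => ∑ k, (α k + t) • v k := by fun_prop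
  have hlim : Filter.Tendsto (fun t : ℝ => ∑ k, (α k + t) • v k) (nhdsWithin 0 (Set.Ioi 0))
      (nhds (∑ k, α k • v k)) := by
    simpa using (hcont.tendsto 0).mono_left nhdsWithin_le_nhds
  refine mem_closure_of_tendsto hlim ?_
  filter_upwards [self_mem_nhdsWithin] with t ht
  exact ⟨_, fun k => add_pos_of_nonneg_of_pos (hα k) ht, rfl⟩

theorem mem_infiniteSimplex_single (x : Fin n → ℝ) :
    x ∈ infiniteSimplex (fun k : Fin n => (Pi.single k 1 : Fin n → ℝ)) ↔ ∀ i, 0 < x i := by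
  have h (α : Fin n → ℝ) : ∑ k, α k • (Pi.single k 1 : Fin n → ℝ) = α := by
    funext i
    simp [Finset.sum_apply, Pi.single_apply]
  constructor
  · rintro ⟨α, hα, rfl⟩
    rwa [h]
  · exact fun hx => ⟨x, hx, (h x).symm⟩

/-- The matrix that sends a linearly independent system `V` to the standard basis. If all vectors
of `V` have `r`-th coordinate `1`, then the new coordinates of `x` add up to `x r`. -/
theorem exists_coordinate_matrix {V : Fin n → Fin n → ℝ} (hV : LinearIndependent ℝ V) (r : Fin n)
    (hr : ∀ k, V k r = 1) :
    ∃ A : Matrix (Fin n) (Fin n) ℝ, (∀ k, A *ᵥ V k = Pi.single k 1) ∧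
      ∀ x : Fin n → ℝ, ∑ k, (A *ᵥ x) k = x r := by
  have hM : IsUnit (of V)ᵀ.det := by
    rw [det_transpose, ← isUnit_iff_isUnit_det]
    exact linearIndependent_rows_iff_isUnit.mp hV
  refine ⟨(of V)ᵀ⁻¹, fun k => ?_, fun x => ?_⟩
  · have : V k = (of V)ᵀ *ᵥ Pi.single k 1 := by
      rw [mulVec_single_one]
      rfl
    rw [this, mulVec_mulVec, nonsing_inv_mul _ hM, one_mulVec]
  · have : x = (of V)ᵀ *ᵥ ((of V)ᵀ⁻¹ *ᵥ x) := by
      rw [mulVec_mulVec, mul_nonsing_inv _ hM, one_mulVec]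
    conv_rhs => rw [this]
    generalize (of V)ᵀ⁻¹ *ᵥ x = y
    simp only [mulVec, dotProduct, transpose_apply, of_apply, hr, one_mul]

/-- The orthant is subdivided first so that one coordinate dominates on every part, then so that the
given layer is linear on every part; the first property passes to the finer parts. -/
theorem exists_isSimplicialDecomposition (N : ReLUNetwork) (hn : 0 < N.width 0) (l : ℕ)
    (j : Fin (N.width l)) :
    ∃ (Q : ℕ) (V : Fin Q → Fin (N.width 0) → Fin (N.width 0) → ℝ)
      (w : Fin Q → Fin (N.width 0) → ℝ) (r : Fin Q → Fin (N.width 0))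
      (A : Fin Q → Matrix (Fin (N.width 0)) (Fin (N.width 0)) ℝ),
      IsSimplicialDecomposition (fun x => N.layer x l j) V w r A := by
  have : NeZero (N.width 0) := ⟨hn.ne'⟩
  let e : Fin (N.width 0) → Fin (N.width 0) → ℝ := fun k => Pi.single k 1
  have hsub : Subdivides (fun u => (∃ w : Fin (N.width 0) → ℝ,
      ∀ x ∈ infiniteSimplex u, N.layer x l j = w ⬝ᵥ x) ∧
      ∃ r, ∀ k, (∀ i, 0 ≤ u k i) ∧ ∀ i, u k i ≤ u k r) e := by
    have h0 : Subdivides (fun u => ∃ r, ∀ k, (∀ i, 0 ≤ u k i) ∧ ∀ i, u k i ≤ u k r) e := by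
      refine ((subdivides_largest e).and_hereditary (Ψ := fun u => ∀ k i, 0 ≤ u k i) ?_ ?_).mono ?_
      · intro u i j a b _ ha hb hu k m
        by_cases hk : k = i
        · subst hk
          have h1 := mul_nonneg ha.le (hu k m)
          have h2 := mul_nonneg hb.le (hu j m)
          simpa using add_nonneg h1 h2
        · simpa [hk] using hu k m
      · intro k i
        simp only [e, Pi.single_apply]
        split_ifs <;> norm_num
      · rintro u ⟨⟨r, hr⟩, h⟩
        exact ⟨r, fun k => ⟨h k, hr k⟩⟩
    refine h0.bind fun u hu => ?_
    refine ((subdivides_layer_linear N l u).and_hereditary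
      (Ψ := fun u => ∃ r, ∀ k, (∀ i, 0 ≤ u k i) ∧ ∀ i, u k i ≤ u k r) ?_ hu).mono
      fun u hu => ⟨hu.1 j, hu.2⟩
    rintro u i j a b _ ha hb ⟨r, hr⟩
    refine ⟨r, fun k => ?_⟩
    by_cases hk : k = i
    · subst hk
      refine ⟨fun m => ?_, fun m => ?_⟩
      · have h1 := mul_nonneg ha.le ((hr k).1 m)
        have h2 := mul_nonneg hb.le ((hr j).1 m)
        simpa using add_nonneg h1 h2
      · have h1 := mul_le_mul_of_nonneg_left ((hr k).2 m) ha.le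
        have h2 := mul_le_mul_of_nonneg_left ((hr j).2 m) hb.le
        simpa using add_le_add h1 h2
    · simpa [hk] using hr k
  have he : LinearIndependent ℝ e := by
    convert (Pi.basisFun ℝ (Fin (N.width 0))).linearIndependent using 1
    funext k
    simp [e]
  obtain ⟨S, hS, hdisj, hcov⟩ := hsub.exists_finset he
  -- the generators are rescaled so that their dominating coordinate becomes `1`
  have hnorm (q : Fin S.card) : ∃ (V : Fin (N.width 0) → Fin (N.width 0) → ℝ)
      (w : Fin (N.width 0) → ℝ) (r : Fin (N.width 0)), LinearIndependent ℝ V ∧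
      infiniteSimplex V = infiniteSimplex (S.equivFin.symm q).1 ∧
      (∀ x ∈ infiniteSimplex V, N.layer x l j = w ⬝ᵥ x) ∧
      (∀ k i, 0 ≤ V k i) ∧ (∀ k i, V k i ≤ V k r) ∧ ∀ k, V k r = 1 := by
    set u := (S.equivFin.symm q).1
    obtain ⟨⟨⟨w, hw⟩, r, hr⟩, hu, -⟩ := hS u (S.equivFin.symm q).2
    have hpos (k) : 0 < u k r := by
      refine lt_of_le_of_ne ((hr k).1 r) fun h => hu.ne_zero k ?_
      funext i
      exact le_antisymm (((hr k).2 i).trans_eq h.symm) ((hr k).1 i)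
    have hcone := infiniteSimplex_smul u (c := fun k => (u k r)⁻¹) fun k => inv_pos.mpr (hpos k)
    refine ⟨fun k => (u k r)⁻¹ • u k, w, r, ?_, hcone, ?_, ?_, ?_, ?_⟩
    · exact hu.units_smul fun k => Units.mk0 _ (inv_ne_zero (hpos k).ne')
    · rwa [hcone]
    · exact fun k i => mul_nonneg (inv_nonneg.mpr (hpos k).le) ((hr k).1 i)
    · exact fun k i => mul_le_mul_of_nonneg_left ((hr k).2 i) (inv_nonneg.mpr (hpos k).le)
    · exact fun k => inv_mul_cancel₀ (hpos k).ne'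
  choose V w r hVi hVc hVw hVn hVr hV1 using hnorm
  choose A hA1 hA2 using fun q => exists_coordinate_matrix (hVi q) (r q) (hV1 q)
  have hpos (q) (x) (hx : x ∈ infiniteSimplex (V q)) (i) : 0 < x i :=
    (mem_infiniteSimplex_single x).mp ((hS _ (S.equivFin.symm q).2).2.2 (hVc q ▸ hx)) i
  refine ⟨S.card, V, w, r, A, hVi, hpos, ?_, ?_, hVw, ?_, hA1, hA2⟩
  · intro q q' hne
    rw [hVc, hVc]
    refine hdisj _ (S.equivFin.symm q).2 _ (S.equivFin.symm q').2 fun h => hne ?_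
    exact S.equivFin.symm.injective (Subtype.ext h)
  · intro x hx
    have hxe : x ∈ closedSimplex e :=
      ⟨x, hx, by funext i; simp [e, Finset.sum_apply, Pi.single_apply]⟩
    obtain ⟨u, hu, hxu⟩ := hcov x hxe
    refine ⟨S.equivFin ⟨u, hu⟩, ?_⟩
    rw [hVc, Equiv.symm_apply_apply]
    exact closedSimplex_subset_closure u hxu
  · intro q x hx i
    rw [abs_of_pos (hpos q x hx i), abs_of_pos (hpos q x hx (r q))]
    obtain ⟨α, hα, rfl⟩ := hx
    simp only [Finset.sum_apply, Pi.smul_apply, smul_eq_mul]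
    exact Finset.sum_le_sum fun k _ => mul_le_mul_of_nonneg_left (hVr q k i) (hα k).le

end Existence

/-! ### The Fourier transform of the standard simplex -/

/-- The standard simplex of size `t`, without its coordinate faces but with the face on which the
coordinates add up to `t`. -/
def scaledSimplex (n : ℕ) (t : ℝ) : Set (Fin n → ℝ) :=
  {x | (∀ i, 0 < x i) ∧ ∑ i, x i ≤ t}

theorem measurableSet_scaledSimplex (n : ℕ) (t : ℝ) : MeasurableSet (scaledSimplex n t) := by
  have h : scaledSimplex n t = (⋂ i, {x | 0 < x i}) ∩ {x | ∑ i, x i ≤ t} := by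
    ext x
    simp [scaledSimplex]
  rw [h]
  exact (MeasurableSet.iInter fun i =>
    measurableSet_lt measurable_const (measurable_pi_apply i)).inter
    (measurableSet_le (Finset.measurable_sum _ fun i _ => measurable_pi_apply i) measurable_const)

theorem scaledSimplex_subset_Icc (n : ℕ) (t : ℝ) :
    scaledSimplex n t ⊆ Set.Icc 0 (fun _ => t) := by
  rintro x ⟨h0, h1⟩
  refine ⟨fun i => (h0 i).le, fun i => ?_⟩
  exact (Finset.single_le_sum (f := x) (fun k _ => (h0 k).le) (Finset.mem_univ i)).trans h1

theorem integrableOn_scaledSimplex {n : ℕ} {t : ℝ} {E : Type*} [NormedAddCommGroup E]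
    {g : (Fin n → ℝ) → E} (hg : Continuous g) :
    IntegrableOn g (scaledSimplex n t) :=
  (hg.continuousOn.integrableOn_compact isCompact_Icc).mono_set (scaledSimplex_subset_Icc n t)

/-- The sum `∑ r, exp (-i v_r t) / ∏_{r' ≠ r} (v_{r'} - v_r)`, up to sign the divided difference of
`x ↦ exp (-i x t)` at the nodes `v`. -/
noncomputable def dividedExp {m : ℕ} (v : Fin m → ℝ) (t : ℝ) : ℂ :=
  ∑ r, Complex.exp (-Complex.I * v r * t) / ∏ r' ∈ Finset.univ.erase r, ((v r' : ℂ) - (v r : ℂ))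

theorem prod_erase_eq_prod_ite {ι M : Type*} [Fintype ι] [DecidableEq ι] [CommMonoid M] (r : ι)
    (g : ι → M) : ∏ x ∈ Finset.univ.erase r, g x = ∏ x, if x = r then 1 else g x := by
  rw [← Finset.prod_erase (a := r) Finset.univ (by simp)]
  refine Finset.prod_congr rfl fun x hx => ?_
  rw [if_neg (Finset.ne_of_mem_erase hx)]

theorem prod_erase_castSucc_snoc {m : ℕ} (v : Fin m → ℝ) (a : ℝ) (r : Fin m) :
    ∏ r' ∈ Finset.univ.erase r.castSucc, (((Fin.snoc v a : Fin (m + 1) → ℝ) r' : ℂ) - (v r : ℂ)) =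
      (∏ r' ∈ Finset.univ.erase r, ((v r' : ℂ) - (v r : ℂ))) * ((a : ℂ) - v r) := by
  rw [prod_erase_eq_prod_ite, prod_erase_eq_prod_ite, Fin.prod_univ_castSucc]
  simp [(Fin.castSucc_ne_last r).symm]

theorem prod_erase_last_snoc {m : ℕ} (v : Fin m → ℝ) (a : ℝ) :
    ∏ r' ∈ Finset.univ.erase (Fin.last m), (((Fin.snoc v a : Fin (m + 1) → ℝ) r' : ℂ) - (a : ℂ)) =
      ∏ r', ((v r' : ℂ) - (a : ℂ)) := by
  rw [prod_erase_eq_prod_ite, Fin.prod_univ_castSucc]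
  simp [Fin.castSucc_ne_last]

theorem dividedExp_snoc {m : ℕ} (v : Fin m → ℝ) (a t : ℝ) :
    dividedExp (Fin.snoc v a : Fin (m + 1) → ℝ) t =
      ∑ r, Complex.exp (-Complex.I * v r * t) /
        ((∏ r' ∈ Finset.univ.erase r, ((v r' : ℂ) - (v r : ℂ))) * ((a : ℂ) - v r)) +
      Complex.exp (-Complex.I * a * t) / ∏ r', ((v r' : ℂ) - (a : ℂ)) := by
  simp only [dividedExp, Fin.sum_univ_castSucc, Fin.snoc_castSucc, Fin.snoc_last,
    prod_erase_castSucc_snoc, prod_erase_last_snoc]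

/-- The divided difference of the constant `1` at two or more nodes vanishes. -/
theorem dividedExp_zero {m : ℕ} {v : Fin (m + 2) → ℝ} (hv : Function.Injective v) :
    dividedExp v 0 = 0 := by
  have h := Lagrange.coeff_eq_sum (s := Finset.univ) (v := fun r => (v r : ℂ))
    (P := (1 : Polynomial ℂ)) (Complex.ofReal_injective.comp hv).injOn (by
      rw [Polynomial.degree_one, Finset.card_univ, Fintype.card_fin]
      exact_mod_cast Nat.succ_pos _)
  rw [Finset.card_univ, Fintype.card_fin, Polynomial.coeff_one, if_neg (by omega)] at h
  rw [dividedExp]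
  have hs (r : Fin (m + 2)) : ∏ r' ∈ Finset.univ.erase r, ((v r' : ℂ) - (v r : ℂ)) =
      (-1) ^ (m + 1) * ∏ r' ∈ Finset.univ.erase r, ((v r : ℂ) - (v r' : ℂ)) := by
    have : (m + 1) = (Finset.univ.erase r).card := by simp
    conv_rhs => rw [this, ← Finset.prod_const, ← Finset.prod_mul_distrib]
    exact Finset.prod_congr rfl fun _ _ => by ring
  simp only [Polynomial.eval_one] at h
  simp only [Complex.ofReal_zero, mul_zero, Complex.exp_zero, hs]
  simp only [one_div, mul_inv] at h ⊢
  rw [← Finset.mul_sum, ← h, mul_zero]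

theorem integral_exp_mul_exp_sub {a b : ℝ} (hab : a ≠ b) (t : ℝ) :
    ∫ s in (0 : ℝ)..t, Complex.exp (-Complex.I * a * s) *
        Complex.exp (-Complex.I * b * (t - s : ℝ)) =
      -Complex.I * ((Complex.exp (-Complex.I * b * t) - Complex.exp (-Complex.I * a * t)) /
        ((a : ℂ) - b)) := by
  have hab' : (a : ℂ) - b ≠ 0 := sub_ne_zero.mpr (by exact_mod_cast hab)
  have hderiv (s : ℝ) : HasDerivAt
      (fun s : ℝ => Complex.I / ((a : ℂ) - b) *
        Complex.exp (-Complex.I * a * s + -Complex.I * b * ((t : ℂ) - s)))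
      (Complex.exp (-Complex.I * a * s) * Complex.exp (-Complex.I * b * (t - s : ℝ))) s := by
    have h1 : HasDerivAt (fun s : ℝ => (s : ℂ)) 1 s := Complex.ofRealCLM.hasDerivAt
    have h2 := (((h1.const_mul (-Complex.I * a)).add
      ((h1.const_sub (t : ℂ)).const_mul (-Complex.I * b))).cexp).const_mul
        (Complex.I / ((a : ℂ) - b))
    refine h2.congr_deriv ?_
    rw [← Complex.exp_add]
    push_cast
    generalize Complex.exp _ = z
    field_simp
    linear_combination (-(a : ℂ) + b) * z * Complex.I_sq
  rw [intervalIntegral.integral_eq_sub_of_hasDerivAt (fun s _ => hderiv s)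
    (Continuous.intervalIntegrable (by fun_prop) _ _)]
  simp only [Complex.ofReal_zero, sub_self, sub_zero, mul_zero, add_zero, zero_add]
  ring

/-- Convolving with one more exponential adds a node to the divided difference. The boundary terms
combine by `dividedExp_zero`. -/
theorem integral_exp_mul_dividedExp {m : ℕ} {v : Fin (m + 1) → ℝ} {a : ℝ}
    (hv : Function.Injective (Fin.snoc v a : Fin (m + 2) → ℝ)) (t : ℝ) :
    ∫ s in (0 : ℝ)..t, Complex.exp (-Complex.I * a * s) * dividedExp v (t - s) =
      -Complex.I * dividedExp (Fin.snoc v a : Fin (m + 2) → ℝ) t := by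
  have hne (r) : a ≠ v r := fun h => by
    have := @hv (Fin.last _) r.castSucc (by simpa using h)
    exact Fin.castSucc_ne_last r this.symm
  have h0 := dividedExp_zero hv
  rw [dividedExp_snoc] at h0 ⊢
  simp only [Complex.ofReal_zero, mul_zero, Complex.exp_zero] at h0
  simp only [dividedExp, Finset.mul_sum, ← mul_div_assoc]
  rw [intervalIntegral.integral_finsetSum
    (fun r _ => Continuous.intervalIntegrable (by fun_prop) _ _)]
  simp only [intervalIntegral.integral_div, integral_exp_mul_exp_sub (hne _)]
  have h1 : (1 : ℂ) / ∏ r', ((v r' : ℂ) - (a : ℂ)) = -∑ r, 1 /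
      ((∏ r' ∈ Finset.univ.erase r, ((v r' : ℂ) - (v r : ℂ))) * ((a : ℂ) - v r)) :=
    eq_neg_of_add_eq_zero_right h0
  rw [div_eq_mul_one_div _ (∏ r', ((v r' : ℂ) - (a : ℂ))), h1, mul_neg, ← sub_eq_add_neg,
    Finset.mul_sum, ← Finset.sum_sub_distrib, Finset.mul_sum]
  refine Finset.sum_congr rfl fun r _ => ?_
  simp only [div_eq_mul_inv, mul_inv]
  ring

/-- The exponential integral over the simplex, sliced along the last coordinate. -/
theorem integral_scaledSimplex_succ {n : ℕ} (ω : Fin n → ℝ) (a : ℝ) {t : ℝ} (ht : 0 ≤ t) :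
    ∫ x in scaledSimplex (n + 1) t,
        Complex.exp (-Complex.I * (((Fin.snoc ω a : Fin (n + 1) → ℝ) ⬝ᵥ x : ℝ) : ℂ)) =
      ∫ s in (0 : ℝ)..t, Complex.exp (-Complex.I * a * s) *
        ∫ y in scaledSimplex n (t - s), Complex.exp (-Complex.I * ((ω ⬝ᵥ y : ℝ) : ℂ)) := by
  set g : (Fin (n + 1) → ℝ) → ℂ := fun x =>
    Complex.exp (-Complex.I * (((Fin.snoc ω a : Fin (n + 1) → ℝ) ⬝ᵥ x : ℝ) : ℂ)) with hg
  have hgc : Continuous g := by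
    simp only [hg, dotProduct]
    fun_prop
  have hint : Integrable ((scaledSimplex (n + 1) t).indicator g) :=
    (integrableOn_scaledSimplex hgc).integrable_indicator (measurableSet_scaledSimplex _ _)
  have hmp := (volume_preserving_piFinSuccAbove (fun _ : Fin (n + 1) => ℝ) (Fin.last n)).symm
  rw [← integral_indicator (measurableSet_scaledSimplex _ _), ← hmp.integral_comp',
    Measure.volume_eq_prod, integral_prod]
  swap
  · exact (hmp.integrable_comp_emb (MeasurableEquiv.measurableEmbedding _)).mpr hint
  rw [intervalIntegral.integral_of_le ht, ← integral_indicator measurableSet_Ioc]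
  congr 1 with s
  have hmem (y : Fin n → ℝ) : (Fin.snoc y s : Fin (n + 1) → ℝ) ∈ scaledSimplex (n + 1) t ↔
      0 < s ∧ y ∈ scaledSimplex n (t - s) := by
    simp only [scaledSimplex, Set.mem_ofPred_eq, Fin.forall_fin_succ', Fin.sum_univ_castSucc,
      Fin.snoc_castSucc, Fin.snoc_last, le_sub_iff_add_le]
    tauto
  have hgs (y : Fin n → ℝ) : g (Fin.snoc y s) =
      Complex.exp (-Complex.I * a * s) * Complex.exp (-Complex.I * ((ω ⬝ᵥ y : ℝ) : ℂ)) := by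
    simp only [hg, dotProduct, Fin.sum_univ_castSucc, Fin.snoc_castSucc, Fin.snoc_last,
      ← Complex.exp_add]
    push_cast
    congr 1
    ring
  simp only [MeasurableEquiv.piFinSuccAbove_symm_apply, Fin.insertNthEquiv, Equiv.coe_fn_mk,
    Fin.insertNth_last']
  by_cases hs : s ∈ Set.Ioc 0 t
  · rw [Set.indicator_of_mem hs, ← integral_const_mul,
      ← integral_indicator (measurableSet_scaledSimplex _ _)]
    congr 1 with y
    by_cases hy : y ∈ scaledSimplex n (t - s)
    · rw [Set.indicator_of_mem hy, Set.indicator_of_mem ((hmem y).mpr ⟨hs.1, hy⟩)]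
      exact hgs y
    · rw [Set.indicator_of_notMem hy, Set.indicator_of_notMem fun h => hy ((hmem y).mp h).2]
  · rw [Set.indicator_of_notMem hs]
    refine integral_eq_zero_of_ae (Filter.Eventually.of_forall fun y => ?_)
    refine Set.indicator_of_notMem (fun h => hs ?_) _
    obtain ⟨h0, h1, h2⟩ := (hmem y).mp h
    exact ⟨h0, sub_nonneg.mp ((Finset.sum_nonneg fun i _ => (h1 i).le).trans h2)⟩

/-- By induction on the dimension: slicing off the last coordinate is a convolution with one more
exponential. Simplices of every size `t` occur in the induction. -/
theorem integral_scaledSimplex {n : ℕ} {ω : Fin n → ℝ}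
    (hω : Function.Injective (Fin.cons 0 ω : Fin (n + 1) → ℝ)) {t : ℝ} (ht : 0 ≤ t) :
    ∫ x in scaledSimplex n t, Complex.exp (-Complex.I * ((ω ⬝ᵥ x : ℝ) : ℂ)) =
      (-Complex.I) ^ n * dividedExp (Fin.cons 0 ω : Fin (n + 1) → ℝ) t := by
  induction n generalizing t with
  | zero =>
    have : scaledSimplex 0 t = Set.univ := by
      ext x
      simp [scaledSimplex, ht]
    rw [this]
    simp [dividedExp, dotProduct, measureReal_def, volume_pi]
  | succ n ih =>
    obtain ⟨ω, a, rfl⟩ : ∃ (ω' : Fin n → ℝ) (a : ℝ), ω = (Fin.snoc ω' a : Fin (n + 1) → ℝ) :=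
      ⟨Fin.init ω, ω (Fin.last n), (Fin.snoc_init_self ω).symm⟩
    rw [Fin.cons_snoc_eq_snoc_cons] at hω ⊢
    have hω' : Function.Injective (Fin.cons 0 ω : Fin (n + 1) → ℝ) := by
      have h := hω.comp (Fin.castSucc_injective (n + 1))
      convert h using 1
      funext i
      simp
    rw [integral_scaledSimplex_succ ω a ht, pow_succ, mul_assoc,
      ← integral_exp_mul_dividedExp hω, ← intervalIntegral.integral_const_mul]
    refine intervalIntegral.integral_congr fun s hs => ?_
    rw [Set.uIcc_of_le ht] at hs
    simp only [ih hω' (sub_nonneg.mpr hs.2)]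
    ring

theorem simplexFn_eq_indicator (n : ℕ) :
    simplexFn n = (scaledSimplex n 1).indicator fun _ => 1 := by
  unfold simplexFn
  congr 1
  ext x
  simp only [Set.mem_ofPred_eq, mem_infiniteSimplex_single, scaledSimplex]

theorem integrable_simplexFn (n : ℕ) : Integrable (simplexFn n) := by
  rw [simplexFn_eq_indicator]
  exact (integrableOn_scaledSimplex continuous_const).integrable_indicator
    (measurableSet_scaledSimplex n 1)

theorem simplexFT_eq_simplexFTFormula {n : ℕ} {ω : Fin n → ℝ}
    (hω : Function.Injective (Fin.cons 0 ω : Fin (n + 1) → ℝ)) :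
    simplexFT n ω = simplexFTFormula n ω := by
  have h : (∫ x : Fin n → ℝ, Complex.exp (-Complex.I * ((ω ⬝ᵥ x : ℝ) : ℂ)) * (simplexFn n x : ℂ)) =
      ∫ x in scaledSimplex n 1, Complex.exp (-Complex.I * ((ω ⬝ᵥ x : ℝ) : ℂ)) := by
    rw [← integral_indicator (measurableSet_scaledSimplex n 1), simplexFn_eq_indicator]
    congr 1 with x
    by_cases hx : x ∈ scaledSimplex n 1 <;> simp [hx]
  rw [simplexFT, fourierTr, h, integral_scaledSimplex hω zero_le_one, simplexFTFormula,
    ← mul_assoc, ← mul_pow]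
  simp only [dividedExp, Complex.ofReal_one, mul_one]
  congr 2
  push_cast
  ring

/-! ### Derivatives of a Fourier transform -/

section Gradient

variable {n : ℕ}

/-- The pairing `(x, y) ↦ x · y / (2π)`, for which Mathlib's Fourier kernel `e^(-2πi L x y)` is
`e^(-i x · y)`. -/
noncomputable def scaledDot (n : ℕ) : (Fin n → ℝ) →L[ℝ] (Fin n → ℝ) →L[ℝ] ℝ :=
  (2 * Real.pi)⁻¹ • LinearMap.toContinuousLinearMap
    (LinearMap.toContinuousLinearMap.toLinearMap ∘ₗ dotProductBilin ℝ ℝ)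

theorem scaledDot_apply (x y : Fin n → ℝ) : scaledDot n x y = (2 * Real.pi)⁻¹ * (x ⬝ᵥ y) := rfl

theorem fourierTr_eq_vectorFourier (f : (Fin n → ℝ) → ℂ) :
    fourierTr f = fun ω => ((1 / Real.sqrt (2 * Real.pi) : ℝ) : ℂ) ^ n *
      VectorFourier.fourierIntegral Real.fourierChar volume (scaledDot n).toLinearMap₁₂ f ω := by
  funext ω
  rw [fourierTr, VectorFourier.fourierIntegral]
  congr 2 with x
  rw [Circle.smul_def, Real.fourierChar_apply, ContinuousLinearMap.toLinearMap₁₂_apply_apply_apply,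
    scaledDot_apply, smul_eq_mul, dotProduct_comm ω x]
  congr 2
  have : (Real.pi : ℂ) ≠ 0 := by exact_mod_cast Real.pi_ne_zero
  push_cast
  field_simp

variable {f : (Fin n → ℝ) → ℂ}

theorem differentiable_fourierTr (hf : Integrable f) (hf' : Integrable fun x => ‖x‖ * ‖f x‖) :
    Differentiable ℝ (fourierTr f) := by
  rw [fourierTr_eq_vectorFourier]
  exact (VectorFourier.differentiable_fourierIntegral (scaledDot n) hf hf').const_mul _

/-- Differentiation of the Fourier transform multiplies the function by `-i x_k`. -/
theorem grad_fourierTr (hf : Integrable f) (hf' : Integrable fun x => ‖x‖ * ‖f x‖)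
    (ω : Fin n → ℝ) (k : Fin n) :
    grad (fourierTr f) ω k = -Complex.I * fourierTr (fun x => x k * f x) ω := by
  have hd := (VectorFourier.hasFDerivAt_fourierIntegral (scaledDot n) hf hf' ω).const_mul
    (((1 / Real.sqrt (2 * Real.pi) : ℝ) : ℂ) ^ n)
  have hi : Integrable (VectorFourier.fourierSMulRight (scaledDot n) f) := by
    refine (hf'.const_mul (2 * Real.pi * ‖scaledDot n‖)).mono'
      hf.1.fourierSMulRight (Filter.Eventually.of_forall fun x => ?_)
    exact (VectorFourier.norm_fourierSMulRight_le (scaledDot n) f x).trans_eq (by ring)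
  have hπ : (Real.pi : ℂ) ≠ 0 := by exact_mod_cast Real.pi_ne_zero
  have hs : (fun x => VectorFourier.fourierSMulRight (scaledDot n) f x (Pi.single k 1)) =
      (-Complex.I) • fun x => x k * f x := by
    funext x
    rw [VectorFourier.fourierSMulRight_apply, scaledDot_apply, dotProduct_single_one,
      Pi.smul_apply, Complex.real_smul]
    simp only [smul_eq_mul]
    push_cast
    field_simp
  rw [grad]
  conv_lhs => rw [fourierTr_eq_vectorFourier]
  rw [hd.fderiv, _root_.smul_apply,
    Real.fourierIntegral_continuousLinearMap_apply' hi, hs,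
    VectorFourier.fourierIntegral_const_smul, fourierTr_eq_vectorFourier]
  simp only [Pi.smul_apply, smul_eq_mul]
  ring

end Gradient

theorem integrable_simplexFn_ofReal (n : ℕ) : Integrable fun x => (simplexFn n x : ℂ) :=
  (integrable_simplexFn n).ofReal

theorem integrable_mul_simplexFn {n : ℕ} {E : Type*} [RCLike E] {g : (Fin n → ℝ) → E}
    (hg : Continuous g) : Integrable fun x => g x * (simplexFn n x : E) := by
  have : (fun x => g x * (simplexFn n x : E)) = (scaledSimplex n 1).indicator g := by
    funext x
    rw [simplexFn_eq_indicator]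
    by_cases hx : x ∈ scaledSimplex n 1 <;> simp [hx]
  rw [this]
  exact (integrableOn_scaledSimplex hg).integrable_indicator (measurableSet_scaledSimplex n 1)

theorem integrable_norm_mul_norm_simplexFn (n : ℕ) :
    Integrable fun x : Fin n → ℝ => ‖x‖ * ‖(simplexFn n x : ℂ)‖ := by
  have h := (integrable_mul_simplexFn (n := n) (E := ℝ) continuous_norm).norm
  refine h.congr (Filter.Eventually.of_forall fun x => ?_)
  simp

theorem differentiable_simplexFT (n : ℕ) : Differentiable ℝ (simplexFT n) :=
  differentiable_fourierTr (integrable_simplexFn_ofReal n) (integrable_norm_mul_norm_simplexFn n)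

/-! ### The pieces of a decomposition -/

section Piece

variable {n : ℕ} {V : Fin n → Fin n → ℝ} {A : Matrix (Fin n) (Fin n) ℝ}

theorem mul_transpose_of_eq_one (hA : ∀ k, A *ᵥ V k = Pi.single k 1) : A * (of V)ᵀ = 1 := by
  ext i k
  have := congrFun (hA k) i
  simpa [mul_apply, mulVec, dotProduct, one_apply, Pi.single_apply] using this

theorem mem_infiniteSimplex_iff (hA : ∀ k, A *ᵥ V k = Pi.single k 1) (x : Fin n → ℝ) :
    x ∈ infiniteSimplex V ↔ ∀ k, 0 < (A *ᵥ x) k := by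
  have hsum (α : Fin n → ℝ) : ∑ k, α k • V k = (of V)ᵀ *ᵥ α := by
    funext i
    simp [mulVec, dotProduct, Finset.sum_apply, mul_comm]
  constructor
  · rintro ⟨α, hα, rfl⟩
    rwa [hsum, mulVec_mulVec, mul_transpose_of_eq_one hA, one_mulVec]
  · intro h
    refine ⟨A *ᵥ x, h, ?_⟩
    rw [hsum, mulVec_mulVec, mul_eq_one_comm.mp (mul_transpose_of_eq_one hA), one_mulVec]

theorem isUnit_det_of_map_basis (hA : ∀ k, A *ᵥ V k = Pi.single k 1) : IsUnit A.det :=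
  isUnit_det_of_right_inverse (mul_transpose_of_eq_one hA)

theorem infiniteSimplex_eq_preimage (hA : ∀ k, A *ᵥ V k = Pi.single k 1) :
    infiniteSimplex V = A.mulVecLin ⁻¹' Set.univ.pi fun _ => Set.Ioi 0 := by
  ext x
  simp [mem_infiniteSimplex_iff hA]

theorem isOpen_infiniteSimplex (hA : ∀ k, A *ᵥ V k = Pi.single k 1) :
    IsOpen (infiniteSimplex V) := by
  rw [infiniteSimplex_eq_preimage hA]
  exact (isOpen_set_pi Set.finite_univ fun _ _ => isOpen_Ioi).preimage
    A.mulVecLin.continuous_of_finiteDimensional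

theorem convex_infiniteSimplex (hA : ∀ k, A *ᵥ V k = Pi.single k 1) :
    Convex ℝ (infiniteSimplex V) := by
  rw [infiniteSimplex_eq_preimage hA]
  exact (convex_pi fun _ _ => convex_Ioi 0).linear_preimage A.mulVecLin

/-- Almost every point of the closure of a simplicial cone is in the open cone, since the frontier
of a convex set is null. -/
theorem ae_mem_infiniteSimplex_of_mem_closure (hA : ∀ k, A *ᵥ V k = Pi.single k 1) :
    ∀ᵐ x : Fin n → ℝ, x ∈ closure (infiniteSimplex V) → x ∈ infiniteSimplex V := by
  have h := (convex_infiniteSimplex hA).addHaar_frontier volume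
  filter_upwards [compl_mem_ae_iff.mpr h] with x hx hc
  by_contra hn
  exact hx ⟨hc, by rwa [(isOpen_infiniteSimplex hA).interior_eq]⟩

variable {r : Fin n}

theorem pieceFn_of_notMem {w x : Fin n → ℝ} (hx : x ∉ infiniteSimplex V) :
    pieceFn V w r x = 0 :=
  Set.indicator_of_notMem (fun h => hx h.1) _

theorem pieceFn_eq (hA : ∀ k, A *ᵥ V k = Pi.single k 1)
    (hr : ∀ x : Fin n → ℝ, ∑ k, (A *ᵥ x) k = x r) (w x : Fin n → ℝ) :
    pieceFn V w r x = (w ⬝ᵥ x) * simplexFn n (A *ᵥ x) := by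
  have h : x ∈ {x | x ∈ infiniteSimplex V ∧ x r ≤ 1} ↔ A *ᵥ x ∈ scaledSimplex n 1 := by
    simp only [Set.mem_ofPred_eq, mem_infiniteSimplex_iff hA, scaledSimplex, hr]
  rw [pieceFn, simplexFn_eq_indicator]
  by_cases hx : A *ᵥ x ∈ scaledSimplex n 1
  · rw [Set.indicator_of_mem (h.mpr hx), Set.indicator_of_mem hx, mul_one]
  · rw [Set.indicator_of_notMem (mt h.mp hx), Set.indicator_of_notMem hx, mul_zero]

theorem integral_comp_mulVec {A : Matrix (Fin n) (Fin n) ℝ} (hA : A.det ≠ 0)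
    {G : (Fin n → ℝ) → ℂ} (hG : Integrable G) :
    Integrable (fun x => G (A *ᵥ x)) ∧
      ∫ x, G (A *ᵥ x) = ((|A.det|⁻¹ : ℝ) : ℂ) * ∫ y, G y := by
  have hmap := Real.map_matrix_volume_pi_eq_smul_volume_pi hA
  have hmeas : Measurable (toLin' A) := (toLin' A).continuous_of_finiteDimensional.measurable
  have hG' : Integrable G (Measure.map (toLin' A) volume) := by
    rw [hmap]
    exact hG.smul_measure ENNReal.ofReal_ne_top
  constructor
  · exact (integrable_map_measure hG'.1 hmeas.aemeasurable).mp hG'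
  · have h := integral_map hmeas.aemeasurable hG'.1
    rw [hmap, integral_smul_measure, ENNReal.toReal_ofReal (abs_nonneg _), abs_inv] at h
    simpa using h.symm

/-- The Fourier transform of a piece: the substitution `y = A x` turns the piece into the standard
simplex, and the linear factor `w · x = (w A⁻¹) · y` into a derivative of `simplexFT`. -/
theorem fourierTr_pieceFn (hA : ∀ k, A *ᵥ V k = Pi.single k 1)
    (hr : ∀ x : Fin n → ℝ, ∑ k, (A *ᵥ x) k = x r) (w ω : Fin n → ℝ) :
    Integrable (fun x => Complex.exp (-Complex.I * ((ω ⬝ᵥ x : ℝ) : ℂ)) * (pieceFn V w r x : ℂ)) ∧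
    fourierTr (fun x => (pieceFn V w r x : ℂ)) ω =
      (Complex.I / (|A.det| : ℝ)) * ∑ k, ((w ᵥ* A⁻¹) k : ℂ) *
        grad (simplexFT n) (ω ᵥ* A⁻¹) k := by
  have hdet := isUnit_det_of_map_basis hA
  set ω' := ω ᵥ* A⁻¹
  set w' := w ᵥ* A⁻¹
  have hdot (z x : Fin n → ℝ) : z ⬝ᵥ x = (z ᵥ* A⁻¹) ⬝ᵥ (A *ᵥ x) := by
    rw [← dotProduct_mulVec, mulVec_mulVec, nonsing_inv_mul _ hdet, one_mulVec]
  let g (k : Fin n) (y : Fin n → ℝ) : ℂ :=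
    Complex.exp (-Complex.I * ((ω' ⬝ᵥ y : ℝ) : ℂ)) * (y k * (simplexFn n y : ℂ))
  have hg (k : Fin n) : Integrable (g k) := by
    have hc : Continuous fun y : Fin n → ℝ =>
        Complex.exp (-Complex.I * ((ω' ⬝ᵥ y : ℝ) : ℂ)) * (y k : ℂ) := by
      simp only [dotProduct]
      fun_prop
    simpa only [g, mul_assoc] using! integrable_mul_simplexFn hc
  have hG : Integrable fun y => ∑ k, (w' k : ℂ) * g k y :=
    integrable_finsetSum _ fun k _ => (hg k).const_mul _
  have heq : (fun x => Complex.exp (-Complex.I * ((ω ⬝ᵥ x : ℝ) : ℂ)) * (pieceFn V w r x : ℂ)) =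
      fun x => ∑ k, (w' k : ℂ) * g k (A *ᵥ x) := by
    funext x
    rw [pieceFn_eq hA hr, hdot ω, hdot w]
    simp only [g, w', ω', dotProduct, Complex.ofReal_mul, Complex.ofReal_sum, Finset.sum_mul,
      Finset.mul_sum]
    refine Finset.sum_congr rfl fun k _ => ?_
    ring
  obtain ⟨h1, h2⟩ := integral_comp_mulVec hdet.ne_zero hG
  refine ⟨by rwa [heq], ?_⟩
  have hgrad (k : Fin n) : grad (simplexFT n) ω' k =
      -Complex.I * fourierTr (fun x => x k * (simplexFn n x : ℂ)) ω' :=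
    grad_fourierTr (integrable_simplexFn_ofReal n) (integrable_norm_mul_norm_simplexFn n) ω' k
  rw [fourierTr, heq, h2, integral_finsetSum _ fun k _ => (hg k).const_mul _]
  simp only [integral_const_mul, hgrad, Finset.mul_sum]
  refine Finset.sum_congr rfl fun k _ => ?_
  rw [fourierTr, Complex.ofReal_inv, div_eq_mul_inv Complex.I]
  generalize ((1 / Real.sqrt (2 * Real.pi) : ℝ) : ℂ) ^ n = c
  change _ = Complex.I * _ * (_ * (-Complex.I * (c * ∫ y, g k y)))
  linear_combination (((|A.det| : ℝ) : ℂ)⁻¹ * (w' k : ℂ) * (c * ∫ y, g k y)) * Complex.I_sq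

end Piece

/-! ### Decompositions of the restriction to the cube -/

theorem continuous_layer (N : ReLUNetwork) (l : ℕ) : Continuous fun x => N.layer x l := by
  induction l with
  | zero => exact continuous_id
  | succ l ih =>
    refine continuous_pi fun j => ?_
    exact continuous_const.max ((continuous_apply j).comp (continuous_const.matrix_mulVec ih))

theorem integrable_cubeRestrict {n : ℕ} {f : (Fin n → ℝ) → ℝ} (hf : Continuous f) :
    Integrable (cubeRestrict f) :=
  (hf.continuousOn.integrableOn_compact isCompact_Icc).integrable_indicator measurableSet_Icc

namespace IsSimplicialDecomposition

variable {n Q : ℕ} {f : (Fin n → ℝ) → ℝ} {V : Fin Q → Fin n → Fin n → ℝ} {w : Fin Q → Fin n → ℝ}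
  {r : Fin Q → Fin n} {A : Fin Q → Matrix (Fin n) (Fin n) ℝ}

/-- On a cone of the decomposition the bound on the dominating coordinate cuts out the part inside
the cube, and the cones cover the orthant up to a null set. -/
theorem ae_cubeRestrict_eq_sum (h : IsSimplicialDecomposition f V w r A) :
    ∀ᵐ x : Fin n → ℝ, cubeRestrict f x = ∑ q, pieceFn (V q) (w q) (r q) x := by
  have hae : ∀ᵐ x : Fin n → ℝ, ∀ q, x ∈ closure (infiniteSimplex (V q)) →
      x ∈ infiniteSimplex (V q) :=
    ae_all_iff.mpr fun q => ae_mem_infiniteSimplex_of_mem_closure (h.map_basis q)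
  filter_upwards [hae] with x hx
  by_cases hq : ∃ q, x ∈ infiniteSimplex (V q)
  · obtain ⟨q, hq⟩ := hq
    have hcube : x ∈ Set.Icc (0 : Fin n → ℝ) 1 ↔ x (r q) ≤ 1 := by
      refine ⟨fun hc => hc.2 (r q), fun hr => ⟨fun i => (h.pos q x hq i).le, fun i => ?_⟩⟩
      have := h.largest q x hq i
      rw [abs_of_pos (h.pos q x hq i), abs_of_pos (h.pos q x hq (r q))] at this
      exact this.trans hr
    rw [Finset.sum_eq_single q _ (by simp)]
    · rw [cubeRestrict, pieceFn]
      by_cases hr : x (r q) ≤ 1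
      · rw [Set.indicator_of_mem (hcube.mpr hr),
          Set.indicator_of_mem
            (show x ∈ {x | x ∈ infiniteSimplex (V q) ∧ x (r q) ≤ 1} from ⟨hq, hr⟩),
          h.linear q x hq]
      · rw [Set.indicator_of_notMem (mt hcube.mp hr),
          Set.indicator_of_notMem fun h => hr h.2]
    · exact fun q' _ hne => pieceFn_of_notMem
        fun h' => Set.disjoint_left.mp (h.disjoint q' q hne) h' hq
  · rw [Finset.sum_eq_zero fun q _ => pieceFn_of_notMem fun h' => hq ⟨q, h'⟩]
    refine Set.indicator_of_notMem (fun hc => hq ?_) _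
    obtain ⟨q, hxq⟩ := h.cover x hc.1
    exact ⟨q, hx q hxq⟩

theorem fourierTr_cubeRestrict (h : IsSimplicialDecomposition f V w r A) (ω : Fin n → ℝ) :
    fourierTr (fun x => (cubeRestrict f x : ℂ)) ω =
      ∑ q, (Complex.I / (|(A q).det| : ℝ)) *
        ∑ k, ((w q ᵥ* (A q)⁻¹) k : ℂ) * grad (simplexFT n) (ω ᵥ* (A q)⁻¹) k := by
  have hq (q) := fourierTr_pieceFn (h.map_basis q) (h.sum_coord q) (w q) ω
  simp only [← (hq _).2]
  simp only [fourierTr]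
  rw [← Finset.mul_sum, ← integral_finsetSum _ fun q _ => (hq q).1]
  congr 1
  refine integral_congr_ae ?_
  filter_upwards [h.ae_cubeRestrict_eq_sum] with x hx
  rw [hx, Complex.ofReal_sum, Finset.mul_sum]

end IsSimplicialDecomposition

theorem mainTheorem1 (N : ReLUNetwork) (hn : 0 < N.width 0)
    (l : ℕ) (hl : l < N.depth) (j : Fin (N.width (l + 1))) :
    (Integrable (simplexFn (N.width 0)) ∧
      Differentiable ℝ (simplexFT (N.width 0)) ∧
      ∀ ω : Fin (N.width 0) → ℝ,
        Function.Injective (Fin.cons 0 ω : Fin (N.width 0 + 1) → ℝ) →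
          simplexFT (N.width 0) ω = simplexFTFormula (N.width 0) ω) ∧
    Integrable (cubeRestrict (fun x => N.layer x (l + 1) j)) ∧
    (∃ (Q : ℕ) (V : Fin Q → Fin (N.width 0) → Fin (N.width 0) → ℝ)
      (w : Fin Q → Fin (N.width 0) → ℝ) (r : Fin Q → Fin (N.width 0))
      (A : Fin Q → Matrix (Fin (N.width 0)) (Fin (N.width 0)) ℝ),
      IsSimplicialDecomposition (fun x => N.layer x (l + 1) j) V w r A) ∧
    ∀ (Q : ℕ) (V : Fin Q → Fin (N.width 0) → Fin (N.width 0) → ℝ)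
      (w : Fin Q → Fin (N.width 0) → ℝ) (r : Fin Q → Fin (N.width 0))
      (A : Fin Q → Matrix (Fin (N.width 0)) (Fin (N.width 0)) ℝ),
      IsSimplicialDecomposition (fun x => N.layer x (l + 1) j) V w r A →
      (∀ᵐ x : Fin (N.width 0) → ℝ, cubeRestrict (fun x => N.layer x (l + 1) j) x =
        ∑ q, pieceFn (V q) (w q) (r q) x) ∧
      ∀ ω : Fin (N.width 0) → ℝ,
        fourierTr (fun x => (cubeRestrict (fun x => N.layer x (l + 1) j) x : ℂ)) ω =
          ∑ q, (Complex.I / (|(A q).det| : ℝ)) *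
            ∑ k, ((w q ᵥ* (A q)⁻¹) k : ℂ) *
              grad (simplexFT (N.width 0)) (ω ᵥ* (A q)⁻¹) k := by
  have hcont : Continuous fun x => N.layer x (l + 1) j :=
    (continuous_apply j).comp (continuous_layer N (l + 1))
  exact ⟨⟨integrable_simplexFn _, differentiable_simplexFT _,
      fun _ hω => simplexFT_eq_simplexFTFormula hω⟩,
    integrable_cubeRestrict hcont, exists_isSimplicialDecomposition N hn (l + 1) j,
    fun _ _ _ _ _ h => ⟨h.ae_cubeRestrict_eq_sum, h.fourierTr_cubeRestrict⟩⟩
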